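/- Let $\varphi:\mathbb R^n\to(-\infty,\infty]$. The regular subdifferential of $\varphi$ at $x$ with $\varphi(x)<\infty$ is $$\widehat\partial\varphi(x)=\Big\{v\in\mathbb R^n\;\Big|\;\liminf_{u\to x,\,u\ne x}\frac{\varphi(u)-\varphi(x)-\langle v,u-x\rangle}{\|u-x\|}\ge 0\Big\},$$ and the limiting subdifferential $\partial\varphi(x)$ is the set of all $v$ for which there are sequences $x_k\to x$ with $\varphi(x_k)\to\varphi(x)$ and $v_k\in\widehat\partial\varphi(x_k)$ with $v_k\to v$; both sets are empty if $\varphi(x)=\infty$. The regular normal cone to $\Omega$ at $p\in\Omega$ is $\widehat N_\Omega(p)=\widehat\partial\delta_\Omega(p)$, where $\delta_\Omega$ is $0$ on $\Omega$ and $\infty$ elsewhere. The graph of a set-valued mapping $F:\mathbb R^n\rightrightarrows\mathbb R^n$ is $\operatorname{gph}F=\{(x,y)\mid y\in F(x)\}$, and for $(x,y)\in\operatorname{gph}F$ its regular coderivative is $\widehat D^*F(x,y)(w)=\{z\mid (z,-w)\in\widehat N_{\operatorname{gph}F}(x,y)\}$, $w\in\mathbb R^n$. The combined second-order subdifferential of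 $\varphi$ is $\breve\partial^2\varphi(u,v)(w)=(\widehat D^*\partial\varphi)(u,v)(w)$. Let $\varphi$ be prox-regular at $\bar x$ for $0\in\partial\varphi(\bar x)$; that is, $\varphi(\bar x)$ is finite, $\varphi$ is lower semicontinuous on a neighborhood of $\bar x$, and there are $\varepsilon>0$ and $r\ge0$ such that $$\varphi(x)\ge\varphi(u)+\langle v,x-u\rangle-\frac r2\|x-u\|^2\qquad(\ast)$$ for all $x,u,v$ with $\|x-\bar x\|<\varepsilon$, $\|u-\bar x\|<\varepsilon$, $\varphi(u)<\varphi(\bar x)+\varepsilon$, $v\in\partial\varphi(u)$ and $\|v\|<\varepsilon$. (If this holds for some $\varepsilon$, it holds for all smaller ones.) For $\varepsilon>0$, let $T_\varepsilon$ be the $\varphi$-attentive $\varepsilon$-localization of $\partial\varphi$ around $(\bar x,0)$: $T_\varepsilon(x)=\{v\in\partial\varphi(x)\mid\|v\|<\varepsilon\}$ if $\|x-\bar x\|<\varepsilon$ and $|\varphi(x)-\varphi(\bar x)|<\varepsilon$, and $T_\varepsilon(x)=\emptyset$ otherwise. **(a)** Suppose that there are $\varepsilon>0$, small enough that the prox-regularity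 condition above is fulfilled with this $\varepsilon$ and some $r\ge0$, and a neighborhood $W$ of $(\bar x,0)$ such that $$\langle z,w\rangle\ge0\quad\text{whenever}\quad z\in\widehat D^*T_\varepsilon(u,v)(w),\ (u,v)\in\operatorname{gph}T_\varepsilon\cap W,\ w\in\mathbb R^n.$$ Then $\bar x$ is a local minimizer of $\varphi$. **(b)** Suppose in addition that $\varphi$ is subdifferentially continuous at $\bar x$ for $0$; that is, $\varphi(x_k)\to\varphi(\bar x)$ whenever $(x_k,v_k)\to(\bar x,0)$ with $v_k\in\partial\varphi(x_k)$ for all $k$. If there are $\varepsilon>0$ (of any size) and a neighborhood $W$ of $(\bar x,0)$ such that $$\langle z,w\rangle\ge0\quad\text{whenever}\quad z\in\breve\partial^2\varphi(u,v)(w),\ (u,v)\in\operatorname{gph}T_\varepsilon\cap W,\ w\in\mathbb R^n,$$ then $\bar x$ is a local minimizer of $\varphi$. -/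

import Mathlib

open Filter Topology

namespace VarAnalysis

variable {E G : Type*}
  [NormedAddCommGroup E] [InnerProductSpace ℝ E]
  [NormedAddCommGroup G] [InnerProductSpace ℝ G]

/-- The Frechet regular subdifferential of `φ` at `x`: all `v` with
`liminf_{u → x, u ≠ x} (φ u - φ x - ⟪v, u - x⟫) / ‖u - x‖ ≥ 0`, and the empty set if `x` is not
in the domain of `φ`. The functions of interest never take the value `-∞`, so all the extended-real
operations below have their usual meaning. -/
def regularSubdifferential (φ : E → EReal) (x : E) : Set E :=
  {v | φ x < ⊤ ∧
    0 ≤ liminf (fun u => (φ u - φ x - ((inner ℝ v (u - x) : ℝ) : EReal)) / ((‖u - x‖ : ℝ) : EReal))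
      (𝓝[≠] x)}

/-- The Mordukhovich limiting subdifferential: limits of regular subgradients `vs k` at points
`xs k → x` with `φ (xs k) → φ x`; empty outside the domain of `φ`. -/
def limitingSubdifferential (φ : E → EReal) (x : E) : Set E :=
  {v | φ x < ⊤ ∧ ∃ (xs vs : ℕ → E),
    Tendsto xs atTop (𝓝 x) ∧ Tendsto (fun k => φ (xs k)) atTop (𝓝 (φ x)) ∧
    Tendsto vs atTop (𝓝 v) ∧ ∀ k, vs k ∈ regularSubdifferential φ (xs k)}

open Classical in
/-- The indicator function of variational analysis: `0` on `Ω` and `∞` off `Ω`. -/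
noncomputable def indicatorFun (Ω : Set E) (x : E) : EReal :=
  if x ∈ Ω then 0 else ⊤

/-- The regular normal cone to `Ω` at `x` (empty if `x ∉ Ω`). -/
def regularNormalCone (Ω : Set E) (x : E) : Set E :=
  regularSubdifferential (indicatorFun Ω) x

/-- The graph of a set-valued mapping, in the product space with its Euclidean (`ℓ²`) structure. -/
def gph (F : E → Set G) : Set (WithLp 2 (E × G)) :=
  {p | p.snd ∈ F p.fst}

/-- The regular coderivative of `F` at `(x, y)`:
`z` belongs to it at `w` iff `(z, -w)` is a regular normal to the graph of `F` at `(x, y)`. -/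
def regularCoderivative (F : E → Set G) (x : E) (y : G) (w : G) : Set E :=
  {z | WithLp.toLp 2 (z, -w) ∈ regularNormalCone (gph F) (WithLp.toLp 2 (x, y))}

/-- The combined second-order subdifferential: the regular coderivative of the limiting
subdifferential mapping. -/
def combinedSecondSubdifferential (φ : E → EReal) (x v : E) (w : E) : Set E :=
  regularCoderivative (limitingSubdifferential φ) x v w

/-- The inequality of prox-regularity, with radius `ε` and constant `r`. -/
def ProxInequality (φ : E → EReal) (xbar vbar : E) (ε r : ℝ) : Prop :=
  ∀ x u v : E, ‖x - xbar‖ < ε → v ∈ limitingSubdifferential φ u → ‖v - vbar‖ < ε →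
    ‖u - xbar‖ < ε → φ u < φ xbar + (ε : EReal) →
    φ u + ((inner ℝ v (x - u) - r / 2 * ‖x - u‖ ^ 2 : ℝ) : EReal) ≤ φ x

/-- `φ` is prox-regular at `xbar` for `vbar ∈ ∂φ(xbar)`. -/
def IsProxRegularAt (φ : E → EReal) (xbar vbar : E) : Prop :=
  vbar ∈ limitingSubdifferential φ xbar ∧
  (φ xbar ≠ ⊥ ∧ φ xbar ≠ ⊤) ∧
  (∀ᶠ x in 𝓝 xbar, LowerSemicontinuousAt φ x) ∧
  ∃ ε : ℝ, 0 < ε ∧ ∃ r : ℝ, 0 ≤ r ∧ ProxInequality φ xbar vbar ε r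

/-- `φ` is subdifferentially continuous at `xbar` for `vbar`. -/
def IsSubdifferentiallyContinuousAt (φ : E → EReal) (xbar vbar : E) : Prop :=
  vbar ∈ limitingSubdifferential φ xbar ∧
  ∀ xs vs : ℕ → E, Tendsto xs atTop (𝓝 xbar) → Tendsto vs atTop (𝓝 vbar) →
    (∀ k, vs k ∈ limitingSubdifferential φ (xs k)) →
    Tendsto (fun k => φ (xs k)) atTop (𝓝 (φ xbar))

/-- The `φ`-attentive `ε`-localization of the subgradient mapping around `(xbar, vbar)`.
For finite `φ xbar`, the two strict inequalities on values say `|φ x - φ xbar| < ε`. -/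
def attentiveLocalization (φ : E → EReal) (xbar vbar : E) (ε : ℝ) (x : E) : Set E :=
  {v | ‖x - xbar‖ < ε ∧ (φ xbar - (ε : EReal) < φ x ∧ φ x < φ xbar + (ε : EReal)) ∧
    v ∈ limitingSubdifferential φ x ∧ ‖v - vbar‖ < ε}

end VarAnalysis

/-! The proof has two variational steps. Each minimizes over a compact set, uses a penalty to keep
the minimizer off the boundary, and reads off a first-order condition.

Step one shows that `⟪v, u - xbar⟫ ≥ 0` for `(u, v)` in the graph of the localization near `(xbar,
0)`. Pass to Cayley coordinates `x = u - xbar + lam • v`, `y = u - xbar - lam • v`. Since `‖x‖² -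
‖y‖² = 4 lam ⟪v, u - xbar⟫`, the claim reads `‖y‖ ≤ ‖x‖`. Fix `e` and `K > ‖e‖`, and minimize `⟪e,
y⟫ + K‖x‖` plus a penalty over a compact piece of the graph. At a minimizer with `x ≠ 0`, the
coderivative condition says `‖q‖ ≤ ‖e‖`, where `q` is the slope of the `x`-terms; but `‖q‖ ≥ K`.
Hence `x = 0`, and prox-regularity leaves only `(xbar, 0)`, with value `0`. Taking `e = -y` and
letting `K` decrease to `‖e‖` gives the claim. Prox-regularity also supplies the compactness
(`half_norm_sq_add_le`, `ProxInequality.isCompact_localGraph`).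

Step two minimizes `φ + c‖· - xbar‖²` plus a penalty on a ball. A minimizer `u ≠ xbar` would have a
subgradient that is a negative multiple of `u - xbar`, against step one. So `xbar` is the minimizer,
and `c → 0` finishes part (a). For part (b), subdifferential continuity makes the graphs of `∂φ` and
of its localization agree locally. -/

namespace VarAnalysis

/-! ### The penalty that keeps minimizers off the boundary. -/

section OuterPenalty

variable {E : Type*} [NormedAddCommGroup E]

/-- A penalty that vanishes on the ball of radius `R / 2` and is positive on the sphere of
radius `R`. -/
noncomputable def outerPenalty (R : ℝ) (x : E) : ℝ := (max 0 (‖x‖ ^ 2 / R ^ 2 - 1 / 4)) ^ 2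

theorem outerPenalty_nonneg (R : ℝ) (x : E) : 0 ≤ outerPenalty R x := sq_nonneg _

theorem outerPenalty_eq_zero {R : ℝ} (hR : 0 < R) {x : E} (hx : ‖x‖ ≤ R / 2) :
    outerPenalty R x = 0 := by
  have h : ‖x‖ ^ 2 / R ^ 2 ≤ 1 / 4 := by
    rw [div_le_iff₀ (by positivity)]
    nlinarith [norm_nonneg x]
  rw [outerPenalty, max_eq_left (by linarith)]
  norm_num

theorem outerPenalty_of_norm_eq {R : ℝ} (hR : 0 < R) {x : E} (hx : ‖x‖ = R) :
    outerPenalty R x = 9 / 16 := by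
  rw [outerPenalty, hx, div_self (by positivity)]
  norm_num

theorem continuous_outerPenalty (R : ℝ) : Continuous (outerPenalty R : E → ℝ) := by
  unfold outerPenalty
  fun_prop

end OuterPenalty

/-! ### One-sided quadratic estimates, which replace derivatives in the optimality conditions. -/

section Majorant

variable {E : Type*} [NormedAddCommGroup E] [InnerProductSpace ℝ E]

/-- `f` is bounded above near `x` by a quadratic function touching it at `x` with slope `p`. -/
def HasQuadraticMajorant (f : E → ℝ) (p x : E) : Prop :=
  ∃ C : ℝ, ∀ᶠ y in 𝓝 x, f y ≤ f x + inner ℝ p (y - x) + C * ‖y - x‖ ^ 2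

theorem HasQuadraticMajorant.add {f g : E → ℝ} {p q x : E} (hf : HasQuadraticMajorant f p x)
    (hg : HasQuadraticMajorant g q x) :
    HasQuadraticMajorant (fun y => f y + g y) (p + q) x := by
  obtain ⟨C, hC⟩ := hf
  obtain ⟨D, hD⟩ := hg
  refine ⟨C + D, ?_⟩
  filter_upwards [hC, hD] with y h1 h2
  rw [inner_add_left]
  linarith

theorem HasQuadraticMajorant.const_mul {f : E → ℝ} {p x : E} (hf : HasQuadraticMajorant f p x)
    {c : ℝ} (hc : 0 ≤ c) : HasQuadraticMajorant (fun y => c * f y) (c • p) x := by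
  obtain ⟨C, hC⟩ := hf
  refine ⟨c * C, ?_⟩
  filter_upwards [hC] with y h1
  rw [real_inner_smul_left]
  linarith [mul_le_mul_of_nonneg_left h1 hc]

theorem norm_sq_sub_norm_sq_eq (x y : E) :
    ‖y‖ ^ 2 - ‖x‖ ^ 2 = 2 * inner ℝ x (y - x) + ‖y - x‖ ^ 2 := by
  have h := norm_add_sq_real x (y - x)
  rw [add_sub_cancel] at h
  linarith

theorem hasQuadraticMajorant_norm_sq (x : E) :
    HasQuadraticMajorant (fun y : E => ‖y‖ ^ 2) ((2 : ℝ) • x) x := by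
  refine ⟨1, Eventually.of_forall fun y => ?_⟩
  have h := norm_sq_sub_norm_sq_eq x y
  simp only [real_inner_smul_left]
  linarith

theorem hasQuadraticMajorant_norm {x : E} (hx : x ≠ 0) :
    HasQuadraticMajorant (fun y : E => ‖y‖) (‖x‖⁻¹ • x) x := by
  have hx0 : 0 < ‖x‖ := norm_pos_iff.2 hx
  refine ⟨(2 * ‖x‖)⁻¹, Eventually.of_forall fun y => ?_⟩
  have h := norm_sq_sub_norm_sq_eq x y
  simp only [real_inner_smul_left]
  -- After multiplication by `‖x‖` this is `2‖x‖‖y‖ ≤ ‖x‖² + ‖y‖²`.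
  have key : ‖y‖ * ‖x‖ ≤ ‖x‖ ^ 2 + inner ℝ x (y - x) + ‖y - x‖ ^ 2 / 2 := by
    nlinarith [sq_nonneg (‖y‖ - ‖x‖)]
  have e : ‖x‖ + ‖x‖⁻¹ * inner ℝ x (y - x) + (2 * ‖x‖)⁻¹ * ‖y - x‖ ^ 2
      = (‖x‖ ^ 2 + inner ℝ x (y - x) + ‖y - x‖ ^ 2 / 2) / ‖x‖ := by
    field_simp
  rw [e, le_div_iff₀ hx0]
  exact key

/-- The derivative `2 max 0 s` is 2-Lipschitz, so the second-order remainder is at most `(t - s)²`.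
-/
theorem max_zero_sq_le (s t : ℝ) :
    (max 0 t) ^ 2 ≤ (max 0 s) ^ 2 + 2 * max 0 s * (t - s) + (t - s) ^ 2 := by
  rcases le_total 0 s with hs | hs <;> rcases le_total 0 t with ht | ht <;>
    simp only [max_eq_left, max_eq_right, hs, ht] <;> nlinarith

theorem hasQuadraticMajorant_outerPenalty {R : ℝ} (hR : 0 < R) (x : E) :
    HasQuadraticMajorant (outerPenalty R)
      ((4 * max 0 (‖x‖ ^ 2 / R ^ 2 - 1 / 4) / R ^ 2) • x) x := by
  set m := max 0 (‖x‖ ^ 2 / R ^ 2 - 1 / 4) with hm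
  refine ⟨2 * m / R ^ 2 + (2 * ‖x‖ + 1) ^ 2 / R ^ 4, ?_⟩
  -- Within distance one, `‖y - x‖² ≤ ‖y - x‖`, so the squared increment of `‖·‖²` is quadratic in
  -- `‖y - x‖`.
  filter_upwards [Metric.ball_mem_nhds x one_pos] with y hy
  rw [mem_ball_iff_norm] at hy
  have h := norm_sq_sub_norm_sq_eq x y
  have h1 := max_zero_sq_le (‖x‖ ^ 2 / R ^ 2 - 1 / 4) (‖y‖ ^ 2 / R ^ 2 - 1 / 4)
  have e : ‖y‖ ^ 2 / R ^ 2 - 1 / 4 - (‖x‖ ^ 2 / R ^ 2 - 1 / 4)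
      = (2 * inner ℝ x (y - x) + ‖y - x‖ ^ 2) / R ^ 2 := by rw [← h]; ring
  rw [e, ← hm] at h1
  simp only [outerPenalty, ← hm, real_inner_smul_left]
  have hb : (2 * inner ℝ x (y - x) + ‖y - x‖ ^ 2) ^ 2 ≤ (2 * ‖x‖ + 1) ^ 2 * ‖y - x‖ ^ 2 := by
    rw [← mul_pow]
    apply sq_le_sq.2
    rw [abs_of_nonneg (a := (2 * ‖x‖ + 1) * ‖y - x‖) (by positivity)]
    have := abs_real_inner_le_norm x (y - x)
    calc |2 * inner ℝ x (y - x) + ‖y - x‖ ^ 2| ≤ |2 * inner ℝ x (y - x)| + |‖y - x‖ ^ 2| :=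
          abs_add_le _ _
      _ ≤ 2 * (‖x‖ * ‖y - x‖) + ‖y - x‖ ^ 2 := by
          rw [abs_mul, abs_two, abs_of_nonneg (sq_nonneg ‖y - x‖)]; linarith
      _ ≤ _ := by nlinarith [norm_nonneg (y - x)]
  have hb' : ((2 * inner ℝ x (y - x) + ‖y - x‖ ^ 2) / R ^ 2) ^ 2
      ≤ (2 * ‖x‖ + 1) ^ 2 / R ^ 4 * ‖y - x‖ ^ 2 := by
    rw [div_pow, div_mul_eq_mul_div, ← pow_mul]
    exact div_le_div_of_nonneg_right hb (by positivity)
  have e2 : 2 * m * ((2 * inner ℝ x (y - x) + ‖y - x‖ ^ 2) / R ^ 2)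
      = 4 * m / R ^ 2 * inner ℝ x (y - x) + 2 * m / R ^ 2 * ‖y - x‖ ^ 2 := by ring
  rw [e2] at h1
  linarith

end Majorant

/-! ### Regular and limiting subgradients: sufficient conditions, locality, closedness. -/

section Subgradients

variable {E : Type*} [NormedAddCommGroup E] [InnerProductSpace ℝ E]

/-- The difference quotient is at least `-C‖u - x‖`, which tends to `0`. -/
theorem mem_regularSubdifferential_of_eventually_le {φ : E → EReal} {x v : E} {a C : ℝ}
    (ha : φ x = a)
    (h : ∀ᶠ u in 𝓝 x, ((a + inner ℝ v (u - x) - C * ‖u - x‖ ^ 2 : ℝ) : EReal) ≤ φ u) :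
    v ∈ regularSubdifferential φ x := by
  refine ⟨ha ▸ EReal.coe_lt_top a, le_of_forall_lt fun c hc => ?_⟩
  obtain ⟨d, hcd, hd⟩ := EReal.lt_iff_exists_real_btwn.1 hc
  refine hcd.trans_le (le_liminf_of_le (by isBoundedDefault) ?_)
  have hd0 : d < 0 := by exact_mod_cast hd
  have ht : Tendsto (fun u => -(C * ‖u - x‖)) (𝓝 x) (𝓝 0) := by
    have : Continuous fun u : E => -(C * ‖u - x‖) := by fun_prop
    simpa using this.tendsto x
  filter_upwards [nhdsWithin_le_nhds h, nhdsWithin_le_nhds (ht.eventually_const_lt hd0),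
    self_mem_nhdsWithin] with u hu hu2 hne
  have hpos : 0 < ‖u - x‖ := norm_pos_iff.2 (sub_ne_zero.2 hne)
  rw [EReal.le_div_iff_mul_le (by exact_mod_cast hpos) (EReal.coe_ne_top _), ha]
  have key : d * ‖u - x‖ ≤ -(C * ‖u - x‖ ^ 2) := by nlinarith
  induction hφ : φ u with
  | bot => exact absurd (hφ ▸ hu) (not_le.2 (EReal.bot_lt_coe _))
  | top => simp
  | coe b =>
    rw [hφ] at hu
    have hu' : a + inner ℝ v (u - x) - C * ‖u - x‖ ^ 2 ≤ b := by exact_mod_cast hu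
    have : d * ‖u - x‖ ≤ b - a - inner ℝ v (u - x) := by linarith
    exact_mod_cast this

theorem mem_regularNormalCone_of_eventually_le {Ω : Set E} {x v : E} {C : ℝ} (hx : x ∈ Ω)
    (h : ∀ᶠ u in 𝓝 x, u ∈ Ω → inner ℝ v (u - x) ≤ C * ‖u - x‖ ^ 2) :
    v ∈ regularNormalCone Ω x := by
  refine mem_regularSubdifferential_of_eventually_le (a := 0) (C := C)
    (by simp [indicatorFun, hx]) ?_
  filter_upwards [h] with u hu
  by_cases hΩ : u ∈ Ω
  · have := hu hΩ
    simp only [indicatorFun, hΩ, if_true]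
    have h2 : 0 + inner ℝ v (u - x) - C * ‖u - x‖ ^ 2 ≤ 0 := by linarith
    exact_mod_cast h2
  · simp [indicatorFun, hΩ]

theorem regularNormalCone_congr {Ω Ω' : Set E} {x : E} (h : ∀ᶠ u in 𝓝 x, u ∈ Ω ↔ u ∈ Ω') :
    regularNormalCone Ω x = regularNormalCone Ω' x := by
  have h' : ∀ᶠ u in 𝓝 x, indicatorFun Ω u = indicatorFun Ω' u := by
    filter_upwards [h] with u hu
    by_cases hΩ : u ∈ Ω
    · simp [indicatorFun, hΩ, hu.1 hΩ]
    · simp [indicatorFun, hΩ, mt hu.2 hΩ]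
  have hx := h'.self_of_nhds
  ext v
  simp only [regularNormalCone, regularSubdifferential, Set.mem_ofPred_eq, hx]
  rw [liminf_congr]
  filter_upwards [nhdsWithin_le_nhds h'] with u hu
  rw [hu]

/-- Writing limiting subgradients as a slice of a closure makes their stability under `φ`-attentive
limits immediate, without diagonal sequences. -/
theorem mem_limitingSubdifferential_iff {φ : E → EReal} {x v : E} :
    v ∈ limitingSubdifferential φ x ↔ φ x < ⊤ ∧
      (x, φ x, v) ∈ closure {p : E × EReal × E |
        p.2.1 = φ p.1 ∧ p.2.2 ∈ regularSubdifferential φ p.1} := by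
  refine and_congr_right fun _ => ?_
  rw [mem_closure_iff_seq_limit]
  constructor
  · rintro ⟨xs, vs, h1, h2, h3, h4⟩
    exact ⟨fun k => (xs k, φ (xs k), vs k), fun k => ⟨rfl, h4 k⟩,
      h1.prodMk_nhds (h2.prodMk_nhds h3)⟩
  · rintro ⟨p, hp, hlim⟩
    rw [Prod.tendsto_iff, Prod.tendsto_iff] at hlim
    exact ⟨fun k => (p k).1, fun k => (p k).2.2, hlim.1,
      hlim.2.1.congr fun k => (hp k).1, hlim.2.2, fun k => (hp k).2⟩

theorem regularSubdifferential_subset_limitingSubdifferential (φ : E → EReal) (x : E) :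
    regularSubdifferential φ x ⊆ limitingSubdifferential φ x := fun _ hv =>
  mem_limitingSubdifferential_iff.2 ⟨hv.1, subset_closure ⟨rfl, hv⟩⟩

theorem mem_limitingSubdifferential_of_tendsto {φ : E → EReal} {x v : E} {xs vs : ℕ → E}
    (hx : φ x < ⊤) (hxs : Tendsto xs atTop (𝓝 x))
    (hφ : Tendsto (fun k => φ (xs k)) atTop (𝓝 (φ x))) (hvs : Tendsto vs atTop (𝓝 v))
    (h : ∀ k, vs k ∈ limitingSubdifferential φ (xs k)) : v ∈ limitingSubdifferential φ x :=
  mem_limitingSubdifferential_iff.2 ⟨hx,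
    isClosed_closure.mem_of_tendsto (hxs.prodMk_nhds (hφ.prodMk_nhds hvs))
      (Eventually.of_forall fun k => (mem_limitingSubdifferential_iff.1 (h k)).2)⟩

end Subgradients

/-! ### Monotonicity of the localization relative to `(xbar, 0)`. -/

section Localization

variable {E : Type*} [NormedAddCommGroup E] [InnerProductSpace ℝ E]
  {φ : E → EReal} {xbar : E} {a ε r : ℝ}

theorem ProxInequality.le_of_norm_sub_lt (hP : ProxInequality φ xbar 0 ε r) (ha : φ xbar = a)
    (h0 : (0 : E) ∈ limitingSubdifferential φ xbar) (hε : 0 < ε) {x : E} (hx : ‖x - xbar‖ < ε) :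
    ((a - r / 2 * ‖x - xbar‖ ^ 2 : ℝ) : EReal) ≤ φ x := by
  have h := hP x xbar 0 hx h0 (by simpa using hε) (by simpa using hε)
    (by rw [ha]; exact_mod_cast (by linarith : a < a + ε))
  rw [ha, inner_zero_left] at h
  refine le_trans (le_of_eq ?_) h
  norm_cast
  ring

theorem exists_real_of_mem_attentiveLocalization (ha : φ xbar = a) {u v : E}
    (hv : v ∈ attentiveLocalization φ xbar 0 ε u) :
    ∃ b : ℝ, φ u = b ∧ a - ε < b ∧ b < a + ε := by
  obtain ⟨-, ⟨h1, h2⟩, -, -⟩ := hv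
  rw [ha] at h1 h2
  induction h : φ u with
  | bot => exact absurd (h ▸ h1) not_lt_bot
  | top => exact absurd (h ▸ h2) not_top_lt
  | coe b =>
    rw [h] at h1 h2
    exact ⟨b, rfl, by exact_mod_cast h1, by exact_mod_cast h2⟩

theorem ProxInequality.real_le (hP : ProxInequality φ xbar 0 ε r) {u v x : E} {b : ℝ}
    (hv : v ∈ attentiveLocalization φ xbar 0 ε u) (hb : φ u = b) (hx : ‖x - xbar‖ < ε) :
    ((b + inner ℝ v (x - u) - r / 2 * ‖x - u‖ ^ 2 : ℝ) : EReal) ≤ φ x := by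
  have h := hP x u v hx hv.2.2.1 hv.2.2.2 hv.1 hv.2.1.2
  rw [hb] at h
  refine le_trans (le_of_eq ?_) h
  norm_cast
  ring

/-- Add the prox-regularity inequality for `(xbar, 0)` tested at `u` to the one for `(u, v)` tested
at `xbar`; the values of `φ` cancel. -/
theorem ProxInequality.neg_mul_norm_sq_le_inner (hP : ProxInequality φ xbar 0 ε r)
    (ha : φ xbar = a) (h0 : (0 : E) ∈ limitingSubdifferential φ xbar) (hε : 0 < ε) {u v : E}
    (hv : v ∈ attentiveLocalization φ xbar 0 ε u) :
    -(r * ‖u - xbar‖ ^ 2) ≤ inner ℝ v (u - xbar) := by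
  obtain ⟨b, hb, -, -⟩ := exists_real_of_mem_attentiveLocalization ha hv
  have h1 := hP.le_of_norm_sub_lt ha h0 hε hv.1
  have h2 := hP.real_le hv hb (x := xbar) (by simpa using hε)
  rw [hb, EReal.coe_le_coe_iff] at h1
  rw [ha, EReal.coe_le_coe_iff, ← neg_sub u xbar, inner_neg_right, norm_neg] at h2
  linarith

/-- The cross term `2 lam ⟪v, x⟫` costs at most `‖x‖² / 2`. Thus `u - xbar + lam • v` controls both
`u - xbar` and `v` on the graph. -/
theorem half_norm_sq_add_le {x v : E} {lam : ℝ} (hlam : 0 < lam)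
    (hlr : 4 * lam * r ≤ 1) (h : -(r * ‖x‖ ^ 2) ≤ inner ℝ v x) :
    ‖x‖ ^ 2 / 2 + lam ^ 2 * ‖v‖ ^ 2 ≤ ‖x + lam • v‖ ^ 2 := by
  rw [norm_add_sq_real, norm_smul, mul_pow, real_inner_smul_right, real_inner_comm v x,
    Real.norm_eq_abs, sq_abs]
  nlinarith [mul_le_mul_of_nonneg_right hlr (sq_nonneg ‖x‖), mul_le_mul_of_nonneg_left h hlam.le]

/-- The strict bounds on `φ` could be lost in the limit. Prox-regularity tested at `xbar` gives them
back with room to spare, by `hsmall`; tested at `u`, it gives the upper half of `φ (us k) → φ u`,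
and lower semicontinuity the lower half. -/
theorem ProxInequality.mem_attentiveLocalization_of_tendsto (hP : ProxInequality φ xbar 0 ε r)
    (ha : φ xbar = a) (h0 : (0 : E) ∈ limitingSubdifferential φ xbar) (hε : 0 < ε)
    {us vs : ℕ → E} {u v : E} (hus : Tendsto us atTop (𝓝 u)) (hvs : Tendsto vs atTop (𝓝 v))
    (hmem : ∀ k, vs k ∈ attentiveLocalization φ xbar 0 ε (us k)) (hu : ‖u - xbar‖ < ε)
    (hv : ‖v‖ < ε) (hlsc : LowerSemicontinuousAt φ u)
    (hsmall : ‖v‖ * ‖u - xbar‖ + r / 2 * ‖u - xbar‖ ^ 2 < ε) :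
    v ∈ attentiveLocalization φ xbar 0 ε u := by
  choose b hb hb1 hb2 using fun k => exists_real_of_mem_attentiveLocalization ha (hmem k)
  have hlow := hP.le_of_norm_sub_lt ha h0 hε hu
  have hlow' : ((a - ε : ℝ) : EReal) < φ u := by
    refine lt_of_lt_of_le ?_ hlow
    have : r / 2 * ‖u - xbar‖ ^ 2 < ε := by nlinarith [norm_nonneg v, norm_nonneg (u - xbar)]
    exact_mod_cast (by linarith : a - ε < a - r / 2 * ‖u - xbar‖ ^ 2)
  have hupp : φ u < ((a + ε : ℝ) : EReal) := by
    -- If `φ u ≥ a + ε`, lower semicontinuity forces `φ (us k) > a + s` eventually, whereas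
    -- prox-regularity tested at `xbar` forces `φ (us k) < a + s`.
    obtain ⟨s, hs1, hs2⟩ := exists_between hsmall
    by_contra! hcon
    have hlt : ((a + s : ℝ) : EReal) < φ u :=
      lt_of_lt_of_le (by exact_mod_cast (by linarith : a + s < a + ε)) hcon
    have hlim : Tendsto (fun k => ‖vs k‖ * ‖us k - xbar‖ + r / 2 * ‖us k - xbar‖ ^ 2) atTop
        (𝓝 (‖v‖ * ‖u - xbar‖ + r / 2 * ‖u - xbar‖ ^ 2)) := by
      have h1 := (hus.sub_const xbar).norm
      exact (hvs.norm.mul h1).add ((h1.pow 2).const_mul _)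
    obtain ⟨k, hk1, hk2⟩ :=
      ((hus.eventually (hlsc _ hlt)).and (hlim.eventually_lt_const hs1)).exists
    have h2 := hP.real_le (hmem k) (hb k) (x := xbar) (by simpa using hε)
    rw [ha, EReal.coe_le_coe_iff, ← neg_sub (us k) xbar, inner_neg_right, norm_neg] at h2
    rw [hb k, gt_iff_lt, EReal.coe_lt_coe_iff] at hk1
    linarith [real_inner_le_norm (vs k) (us k - xbar)]
  obtain ⟨B, hB⟩ : ∃ B : ℝ, φ u = B :=
    ⟨(φ u).toReal, (EReal.coe_toReal (hupp.trans (EReal.coe_lt_top _)).ne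
      ((EReal.bot_lt_coe _).trans hlow').ne').symm⟩
  have hconv : Tendsto (fun k => φ (us k)) atTop (𝓝 (φ u)) := by
    refine tendsto_order.2 ⟨fun c hc => hus.eventually (hlsc c hc), fun c hc => ?_⟩
    have hlim : Tendsto (fun k => B - inner ℝ (vs k) (u - us k) + r / 2 * ‖u - us k‖ ^ 2) atTop
        (𝓝 (B - inner ℝ v (u - u) + r / 2 * ‖u - u‖ ^ 2)) := by
      have h1 := hus.const_sub u
      exact ((hvs.inner h1).const_sub B).add ((h1.norm.pow 2).const_mul _)
    have hlim' := (continuous_coe_real_ereal.tendsto _).comp hlim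
    have hc' : ((B - inner ℝ v (u - u) + r / 2 * ‖u - u‖ ^ 2 : ℝ) : EReal) < c := by
      simpa [hB] using hc
    filter_upwards [hlim'.eventually_lt_const hc'] with k hk
    refine lt_of_le_of_lt ?_ hk
    have h2 := hP.real_le (hmem k) (hb k) hu
    rw [hB, EReal.coe_le_coe_iff] at h2
    rw [hb k, Function.comp_apply, EReal.coe_le_coe_iff]
    linarith
  refine ⟨hu, ⟨?_, ?_⟩, ?_, by simpa using hv⟩
  · rw [ha]; exact_mod_cast hlow'
  · rw [ha]; exact_mod_cast hupp
  · exact mem_limitingSubdifferential_of_tendsto (hupp.trans (EReal.coe_lt_top _)) hus hconv hvs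
      fun k => (hmem k).2.2.1

theorem ProxInequality.isCompact_localGraph [ProperSpace E] (hP : ProxInequality φ xbar 0 ε r)
    (ha : φ xbar = a) (h0 : (0 : E) ∈ limitingSubdifferential φ xbar) (hε : 0 < ε) (hr : 0 ≤ r)
    {lam ρ : ℝ} {S : Set (E × E)}
    (hS : S = {p | p.2 ∈ attentiveLocalization φ xbar 0 ε p.1 ∧ ‖p.1 - xbar + lam • p.2‖ ≤ ρ})
    {α β : ℝ} (hbd : ∀ p ∈ S, ‖p.1 - xbar‖ ≤ α ∧ ‖p.2‖ ≤ β) (hα : α < ε) (hβ : β < ε)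
    (hαβ : β * α + r / 2 * α ^ 2 < ε)
    (hlsc : ∀ u, ‖u - xbar‖ ≤ α → LowerSemicontinuousAt φ u) : IsCompact S := by
  refine (((isCompact_closedBall xbar α).prod (isCompact_closedBall (0 : E) β))).of_isClosed_subset
    ?_ fun p hp => ⟨mem_closedBall_iff_norm.2 (hbd p hp).1, by
      simpa [mem_closedBall_iff_norm] using (hbd p hp).2⟩
  refine IsSeqClosed.isClosed fun ps p hps hlim => ?_
  have h1 : Tendsto (fun k => (ps k).1) atTop (𝓝 p.1) := (continuous_fst.tendsto p).comp hlim
  have h2 : Tendsto (fun k => (ps k).2) atTop (𝓝 p.2) := (continuous_snd.tendsto p).comp hlim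
  have hu : ‖p.1 - xbar‖ ≤ α :=
    le_of_tendsto' (h1.sub_const xbar).norm fun k => (hbd _ (hps k)).1
  have hv : ‖p.2‖ ≤ β := le_of_tendsto' h2.norm fun k => (hbd _ (hps k)).2
  subst hS
  refine ⟨hP.mem_attentiveLocalization_of_tendsto ha h0 hε h1 h2 (fun k => (hps k).1)
    (hu.trans_lt hα) (hv.trans_lt hβ) (hlsc _ hu) (lt_of_le_of_lt ?_ hαβ),
    le_of_tendsto' ((h1.sub_const xbar).add (h2.const_smul lam)).norm fun k => (hps k).2⟩
  have := (norm_nonneg _).trans hv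
  gcongr

/-- A point of the graph where a linear function plus a penalty of `u + lam • v` attains a local
minimum yields an element of the regular coderivative. -/
theorem mem_regularCoderivative_of_isLocalMin {T : E → Set E} {u v e q : E} {lam : ℝ} {Θ : E → ℝ}
    (hlam : 0 < lam) (hv : v ∈ T u) (hΘ : HasQuadraticMajorant Θ q (u - xbar + lam • v))
    (hmin : ∀ᶠ p in 𝓝 (u, v), p.2 ∈ T p.1 →
      inner ℝ e (u - xbar - lam • v) + Θ (u - xbar + lam • v)
        ≤ inner ℝ e (p.1 - xbar - lam • p.2) + Θ (p.1 - xbar + lam • p.2)) :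
    -(e + q) ∈ regularCoderivative T u v (lam • (q - e)) := by
  obtain ⟨C, hC⟩ := hΘ
  have hcont : Tendsto (fun p : E × E => p.1 - xbar + lam • p.2) (𝓝 (u, v))
      (𝓝 (u - xbar + lam • v)) := by
    have : Continuous fun p : E × E => p.1 - xbar + lam • p.2 := by fun_prop
    exact this.tendsto (u, v)
  have hW : Tendsto (fun p : WithLp 2 (E × E) => (p.fst, p.snd))
      (𝓝 (WithLp.toLp 2 (u, v))) (𝓝 (u, v)) :=
    (WithLp.prod_continuous_ofLp 2 E E).tendsto (WithLp.toLp 2 (u, v))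
  refine mem_regularNormalCone_of_eventually_le (C := |C| * (1 + lam) ^ 2) hv ?_
  filter_upwards [hW.eventually hmin, hW.eventually (hcont.eventually hC)] with p hp hpC hpT
  have h1 := hp hpT
  set du := p.fst - u with hdu
  set dv := p.snd - v with hdv
  have e1 : p.fst - xbar + lam • p.snd - (u - xbar + lam • v) = du + lam • dv := by
    rw [hdu, hdv]; module
  have e2 : p.fst - xbar - lam • p.snd = u - xbar - lam • v + (du - lam • dv) := by
    rw [hdu, hdv]; module
  have e3 : inner ℝ (WithLp.toLp 2 (-(e + q), -(lam • (q - e)))) (p - WithLp.toLp 2 (u, v))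
      = inner ℝ (-(e + q)) du + inner ℝ (-(lam • (q - e))) dv := by
    rw [WithLp.prod_inner_apply]; rfl
  have e4 : ‖p - WithLp.toLp 2 (u, v)‖ ^ 2 = ‖du‖ ^ 2 + ‖dv‖ ^ 2 := by
    rw [WithLp.prod_norm_sq_eq_of_L2]; rfl
  have hn : ‖du + lam • dv‖ ^ 2 ≤ (1 + lam) ^ 2 * (‖du‖ ^ 2 + ‖dv‖ ^ 2) := by
    have h := norm_add_le du (lam • dv)
    rw [norm_smul, Real.norm_of_nonneg hlam.le] at h
    have h' : ‖du + lam • dv‖ ^ 2 ≤ (‖du‖ + lam * ‖dv‖) ^ 2 := by gcongr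
    nlinarith [sq_nonneg (lam * ‖du‖ - ‖dv‖), mul_nonneg hlam.le (sq_nonneg ‖du‖),
      mul_nonneg hlam.le (sq_nonneg ‖dv‖)]
  have hCn : C * ‖du + lam • dv‖ ^ 2 ≤ |C| * ((1 + lam) ^ 2 * (‖du‖ ^ 2 + ‖dv‖ ^ 2)) :=
    mul_le_mul (le_abs_self C) hn (sq_nonneg _) (abs_nonneg C)
  rw [e1] at hpC
  rw [e2, inner_add_right] at h1
  rw [e3, e4]
  simp only [inner_add_right, inner_sub_right, inner_add_left, inner_sub_left, inner_neg_left,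
    real_inner_smul_left, real_inner_smul_right] at *
  linarith

/-- If regular coderivatives are positive on a compact piece of the graph of `T`, then
`T` is monotone relative to the point `(xbar, 0)`. -/
theorem inner_nonneg_of_regularCoderivative_nonneg {T : E → Set E} {lam ρ : ℝ} {S : Set (E × E)}
    (hlam : 0 < lam) (hρ : 0 < ρ) (h0 : (0 : E) ∈ T xbar)
    (hS : S = {p | p.2 ∈ T p.1 ∧ ‖p.1 - xbar + lam • p.2‖ ≤ ρ}) (hc : IsCompact S)
    (hbd : ∀ p ∈ S, ‖p.1 - xbar‖ ^ 2 / 2 + lam ^ 2 * ‖p.2‖ ^ 2 ≤ ‖p.1 - xbar + lam • p.2‖ ^ 2)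
    (hpos : ∀ p ∈ S, ∀ w, ∀ z ∈ regularCoderivative T p.1 p.2 w, 0 ≤ inner ℝ z w)
    {u v : E} (hv : v ∈ T u) (huv : ‖u - xbar + lam • v‖ ≤ ρ / 2) :
    0 ≤ inner ℝ v (u - xbar) := by
  set e : E := -(u - xbar - lam • v) with he
  -- This is `‖y‖ ≤ ‖x‖` in Cayley coordinates, with `e = -y`.
  suffices H : ‖e‖ ≤ ‖u - xbar + lam • v‖ by
    have h2 : ‖u - xbar - lam • v‖ ^ 2 ≤ ‖u - xbar + lam • v‖ ^ 2 := by
      rw [he, norm_neg] at H; gcongr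
    rw [norm_sub_sq_real, norm_add_sq_real, real_inner_smul_right, real_inner_comm] at h2
    nlinarith
  have key : ∀ K, ‖e‖ < K → ‖e‖ ^ 2 ≤ K * ‖u - xbar + lam • v‖ := by
    intro K hK
    have hK0 : 0 < K := (norm_nonneg e).trans_lt hK
    -- On the sphere `‖x‖ = ρ` one has `‖y‖ ≤ 3ρ` and the penalty is `9/16`. As `6 · 9/16 > 3`, the
    -- term `K * ρ` makes `F` positive there, above its value `0` at `(xbar, 0)`.
    set N : ℝ := 6 * ρ * ‖e‖ with hN
    have hN0 : 0 ≤ N := by positivity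
    set Θ : E → ℝ := fun y => K * ‖y‖ + N * outerPenalty ρ y with hΘ
    set F : E × E → ℝ := fun p =>
      inner ℝ e (p.1 - xbar - lam • p.2) + Θ (p.1 - xbar + lam • p.2) with hF
    have hFc : Continuous F := by
      have := continuous_outerPenalty (E := E) ρ
      simp only [hF, hΘ]
      fun_prop
    have hmem : ∀ p, p ∈ S ↔ p.2 ∈ T p.1 ∧ ‖p.1 - xbar + lam • p.2‖ ≤ ρ := fun p => by
      rw [hS]; rfl
    have h0S : (xbar, (0 : E)) ∈ S := (hmem _).2 ⟨h0, by simpa using hρ.le⟩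
    have huvS : (u, v) ∈ S := (hmem _).2 ⟨hv, by dsimp only; linarith⟩
    have hF0 : F (xbar, 0) = 0 := by
      simp [hF, hΘ, outerPenalty_eq_zero hρ (x := (0 : E)) (by simpa using (half_pos hρ).le)]
    obtain ⟨p, hpS, hpmin⟩ := hc.exists_isMinOn ⟨_, h0S⟩ hFc.continuousOn
    have hp0 : F p ≤ 0 := hF0 ▸ hpmin h0S
    obtain ⟨hpT, hpρ⟩ := (hmem p).1 hpS
    have hb := hbd p hpS
    have hu1 : ‖p.1 - xbar‖ ≤ 2 * ‖p.1 - xbar + lam • p.2‖ := by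
      apply (sq_le_sq₀ (by positivity) (by positivity)).1
      nlinarith [sq_nonneg (lam * ‖p.2‖), sq_nonneg ‖p.1 - xbar + lam • p.2‖]
    have hv1 : lam * ‖p.2‖ ≤ ‖p.1 - xbar + lam • p.2‖ := by
      apply (sq_le_sq₀ (by positivity) (by positivity)).1
      nlinarith [sq_nonneg ‖p.1 - xbar‖]
    have hlt : ‖p.1 - xbar + lam • p.2‖ < ρ := by
      refine lt_of_le_of_ne hpρ fun heq => ?_
      have h1 : -(‖e‖ * (3 * ρ)) ≤ inner ℝ e (p.1 - xbar - lam • p.2) := by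
        have h2 := norm_sub_le (p.1 - xbar) (lam • p.2)
        rw [norm_smul, Real.norm_of_nonneg hlam.le] at h2
        have h3 := mul_le_mul_of_nonneg_left (h2.trans (by linarith : _ ≤ 3 * ρ)) (norm_nonneg e)
        linarith [neg_le_of_abs_le (abs_real_inner_le_norm e (p.1 - xbar - lam • p.2))]
      have h4 : F p = inner ℝ e (p.1 - xbar - lam • p.2) + (K * ρ + N * (9 / 16)) := by
        simp only [hF, hΘ, heq, outerPenalty_of_norm_eq hρ heq]
      nlinarith [mul_pos hK0 hρ, mul_nonneg hρ.le (norm_nonneg e)]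
    have hx0 : p.1 - xbar + lam • p.2 = 0 := by
      by_contra hx
      set x := p.1 - xbar + lam • p.2 with hxdef
      set m := max 0 (‖x‖ ^ 2 / ρ ^ 2 - 1 / 4)
      set q : E := K • ‖x‖⁻¹ • x + N • (4 * m / ρ ^ 2) • x with hq
      have hmaj : HasQuadraticMajorant Θ q x :=
        ((hasQuadraticMajorant_norm hx).const_mul hK0.le).add
          ((hasQuadraticMajorant_outerPenalty hρ x).const_mul hN0)
      have hcont : Tendsto (fun p : E × E => ‖p.1 - xbar + lam • p.2‖) (𝓝 p) (𝓝 ‖x‖) := by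
        have : Continuous fun p : E × E => ‖p.1 - xbar + lam • p.2‖ := by fun_prop
        exact this.tendsto p
      have hz := mem_regularCoderivative_of_isLocalMin hlam hpT hmaj (e := e) (by
        filter_upwards [hcont.eventually_lt_const hlt] with p' hp' hp'T
        exact hpmin ((hmem p').2 ⟨hp'T, hp'.le⟩))
      have h1 := hpos p hpS _ _ hz
      have h2 : inner ℝ (-(e + q)) (lam • (q - e)) = lam * (‖e‖ ^ 2 - ‖q‖ ^ 2) := by
        rw [real_inner_smul_right, inner_neg_left, inner_add_left, inner_sub_right,
          inner_sub_right, real_inner_self_eq_norm_sq, real_inner_self_eq_norm_sq,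
          real_inner_comm]
        ring
      -- The penalty's slope points along `x`, as does that of the norm, so it can only lengthen
      -- `q`.
      have hqn : K ≤ ‖q‖ := by
        have hxn : 0 < ‖x‖ := norm_pos_iff.2 hx
        have hm : 0 ≤ m := le_max_left _ _
        have e1 : q = (K * ‖x‖⁻¹ + N * (4 * m / ρ ^ 2)) • x := by rw [hq]; module
        rw [e1, norm_smul, Real.norm_of_nonneg (by positivity), add_mul,
          inv_mul_cancel_right₀ hxn.ne']
        have : 0 ≤ N * (4 * m / ρ ^ 2) * ‖x‖ := by positivity
        linarith
      rw [h2] at h1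
      have h3 := nonneg_of_mul_nonneg_right h1 hlam
      nlinarith [norm_nonneg e]
    have hp1 : p.1 = xbar := by
      rw [hx0, norm_zero, mul_zero] at hu1
      exact sub_eq_zero.1 (norm_le_zero_iff.1 hu1)
    have hp2 : p.2 = 0 := by
      rw [hx0, norm_zero] at hv1
      exact norm_le_zero_iff.1 (nonpos_of_mul_nonpos_right hv1 hlam)
    have h5 : F p ≤ F (u, v) := hpmin huvS
    rw [show p = (xbar, 0) from Prod.ext hp1 hp2, hF0] at h5
    have h6 : F (u, v) = -‖e‖ ^ 2 + K * ‖u - xbar + lam • v‖ := by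
      have h7 : u - xbar - lam • v = -e := by rw [he, neg_neg]
      simp only [hF, hΘ, h7, outerPenalty_eq_zero hρ huv, inner_neg_right,
        real_inner_self_eq_norm_sq, mul_zero, add_zero]
    linarith
  -- Let `K` decrease to `‖e‖`.
  have hlim : ‖e‖ ^ 2 ≤ ‖e‖ * ‖u - xbar + lam • v‖ := by
    refine ge_of_tendsto (x := 𝓝[>] ‖e‖) (f := fun K => K * ‖u - xbar + lam • v‖) ?_
      (by filter_upwards [self_mem_nhdsWithin] with K hK using key K hK)
    exact ((continuous_id.mul continuous_const).tendsto ‖e‖).mono_left nhdsWithin_le_nhds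
  by_contra! hcon
  nlinarith [norm_nonneg (u - xbar + lam • v)]

end Localization

/-! ### From monotonicity to a local minimum. -/

section LocalMinimum

variable {E : Type*} [NormedAddCommGroup E] [InnerProductSpace ℝ E]
  {φ : E → EReal} {xbar : E} {a ε r : ℝ}

theorem ProxInequality.exists_inner_nonneg [ProperSpace E] (hP : ProxInequality φ xbar 0 ε r)
    (ha : φ xbar = a) (h0 : (0 : E) ∈ limitingSubdifferential φ xbar) (hε : 0 < ε) (hr : 0 ≤ r)
    (hlsc : ∀ᶠ x in 𝓝 xbar, LowerSemicontinuousAt φ x) {W : Set (E × E)}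
    (hW : W ∈ 𝓝 (xbar, (0 : E)))
    (hpos : ∀ u v w z : E, v ∈ attentiveLocalization φ xbar 0 ε u → (u, v) ∈ W →
      z ∈ regularCoderivative (attentiveLocalization φ xbar 0 ε) u v w → 0 ≤ inner ℝ z w) :
    ∃ δ > 0, ∀ u v : E, v ∈ attentiveLocalization φ xbar 0 ε u → ‖u - xbar‖ < δ → ‖v‖ < δ →
      0 ≤ inner ℝ v (u - xbar) := by
  obtain ⟨d₁, hd₁, hd₁W⟩ := Metric.mem_nhds_iff.1 hW
  obtain ⟨d₂, hd₂, hd₂l⟩ := Metric.eventually_nhds_iff_ball.1 hlsc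
  -- The bounds `d < 1` and `d < ε / (1 + r)` yield `d² + r / 2 * d² < ε`, as closedness of the
  -- graph piece requires.
  obtain ⟨d, hd, hdd⟩ : ∃ d : ℝ, 0 < d ∧ d < d₁ ∧ d < d₂ ∧ d < ε ∧ d < 1 ∧ d < ε / (1 + r) := by
    obtain ⟨d, h, h'⟩ := exists_between
      (show 0 < min d₁ (min d₂ (min ε (min 1 (ε / (1 + r))))) by positivity)
    simp only [lt_min_iff] at h'
    exact ⟨d, h, h'⟩
  obtain ⟨h1, h2, h3, h4, h5⟩ := hdd
  rw [lt_div_iff₀ (by positivity)] at h5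
  -- Using `r + 1` instead of `r` covers `r = 0` and keeps `lam ≤ 1 / 4`.
  set lam : ℝ := 1 / (4 * (r + 1)) with hlam_def
  have hlam : 0 < lam := by positivity
  have hlr : 4 * lam * (r + 1) = 1 := by rw [hlam_def]; field_simp
  have hlr' : 4 * lam * r ≤ 1 := by linarith
  have hlam4 : lam ≤ 1 / 4 := by nlinarith
  -- By `half_norm_sq_add_le`, `‖x‖ ≤ ρ` forces `‖u - xbar‖ ≤ d` and `‖v‖ ≤ d`.
  set ρ : ℝ := lam * d / 2 with hρ_def
  have hρ : 0 < ρ := by positivity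
  have h0T : (0 : E) ∈ attentiveLocalization φ xbar 0 ε xbar := by
    refine ⟨by simpa using hε, ⟨?_, ?_⟩, h0, by simpa using hε⟩
    · rw [ha]; exact_mod_cast (by linarith : a - ε < a)
    · rw [ha]; exact_mod_cast (by linarith : a < a + ε)
  set S : Set (E × E) :=
    {p | p.2 ∈ attentiveLocalization φ xbar 0 ε p.1 ∧ ‖p.1 - xbar + lam • p.2‖ ≤ ρ} with hS
  have hco : ∀ p ∈ S,
      ‖p.1 - xbar‖ ^ 2 / 2 + lam ^ 2 * ‖p.2‖ ^ 2 ≤ ‖p.1 - xbar + lam • p.2‖ ^ 2 := fun p hp =>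
    half_norm_sq_add_le hlam hlr' (hP.neg_mul_norm_sq_le_inner ha h0 hε hp.1)
  have hbd : ∀ p ∈ S, ‖p.1 - xbar‖ ≤ d ∧ ‖p.2‖ ≤ d := by
    intro p hp
    have hb := hco p hp
    have hb2 : ‖p.1 - xbar + lam • p.2‖ ^ 2 ≤ ρ ^ 2 := by gcongr; exact hp.2
    have hρ2 : ρ ^ 2 = lam ^ 2 * d ^ 2 / 4 := by rw [hρ_def]; ring
    have hl2 : lam ^ 2 ≤ 1 := by nlinarith
    constructor
    · apply (sq_le_sq₀ (norm_nonneg _) hd.le).1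
      nlinarith [mul_le_mul_of_nonneg_right hl2 (sq_nonneg d), sq_nonneg (lam * ‖p.2‖)]
    · apply (sq_le_sq₀ (norm_nonneg _) hd.le).1
      have : lam ^ 2 * ‖p.2‖ ^ 2 ≤ lam ^ 2 * d ^ 2 := by
        nlinarith [sq_nonneg ‖p.1 - xbar‖, sq_nonneg (lam * d)]
      exact le_of_mul_le_mul_left this (by positivity)
  have hcpt : IsCompact S := hP.isCompact_localGraph ha h0 hε hr hS hbd h3 h3
    (by nlinarith) fun u hu => hd₂l u (by rw [mem_ball_iff_norm]; linarith)
  refine ⟨ρ / 4, by positivity, fun u v hv hu1 hv1 =>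
    inner_nonneg_of_regularCoderivative_nonneg hlam hρ h0T hS hcpt hco ?_ hv ?_⟩
  · intro p hp w z hz
    refine hpos p.1 p.2 w z hp.1 (hd₁W ?_) hz
    rw [mem_ball_iff_norm, Prod.norm_def, max_lt_iff]
    have := hbd p hp
    exact ⟨by simpa using this.1.trans_lt h1, by simpa using this.2.trans_lt h1⟩
  · have := norm_add_le (u - xbar) (lam • v)
    rw [norm_smul, Real.norm_of_nonneg hlam.le] at this
    nlinarith [norm_nonneg v]

theorem mem_limitingSubdifferential_of_isLocalMin {u q : E} {b : ℝ} {Θ : E → ℝ} (hb : φ u = b)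
    (hΘ : HasQuadraticMajorant Θ q (u - xbar))
    (hmin : ∀ᶠ y in 𝓝 u, φ u + (Θ (u - xbar) : EReal) ≤ φ y + (Θ (y - xbar) : EReal)) :
    -q ∈ limitingSubdifferential φ u := by
  obtain ⟨C, hC⟩ := hΘ
  have hcont : Tendsto (fun y => y - xbar) (𝓝 u) (𝓝 (u - xbar)) := tendsto_id.sub_const xbar
  refine regularSubdifferential_subset_limitingSubdifferential φ u
    (mem_regularSubdifferential_of_eventually_le (C := C) hb ?_)
  filter_upwards [hmin, hcont.eventually hC] with y h1 h2
  rw [sub_sub_sub_cancel_right] at h2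
  induction hy : φ y with
  | bot =>
    rw [hy, hb, EReal.bot_add, ← EReal.coe_add] at h1
    exact absurd h1 (not_le.2 (EReal.bot_lt_coe _))
  | top => exact le_top
  | coe c =>
    rw [hy, hb, ← EReal.coe_add, ← EReal.coe_add, EReal.coe_le_coe_iff] at h1
    rw [EReal.coe_le_coe_iff, inner_neg_left]
    linarith

theorem ProxInequality.isLocalMin_of_inner_nonneg [ProperSpace E]
    (hP : ProxInequality φ xbar 0 ε r)
    (ha : φ xbar = a) (h0 : (0 : E) ∈ limitingSubdifferential φ xbar) (hε : 0 < ε) (hr : 0 ≤ r)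
    (hlsc : ∀ᶠ x in 𝓝 xbar, LowerSemicontinuousAt φ x) {δ : ℝ} (hδ : 0 < δ)
    (hmono : ∀ u v : E, v ∈ attentiveLocalization φ xbar 0 ε u → ‖u - xbar‖ < δ → ‖v‖ < δ →
      0 ≤ inner ℝ v (u - xbar)) : IsLocalMin φ xbar := by
  obtain ⟨d₂, hd₂, hd₂l⟩ := Metric.eventually_nhds_iff_ball.1 hlsc
  obtain ⟨R, hR, hRR⟩ : ∃ R : ℝ, 0 < R ∧ R < δ ∧ R < d₂ ∧ R < ε ∧ R < 1 ∧
      R < ε / (2 + 4 * r) ∧ R < δ / (2 + 4 * r) := by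
    obtain ⟨d, h, h'⟩ := exists_between
      (show 0 < min δ (min d₂ (min ε (min 1 (min (ε / (2 + 4 * r)) (δ / (2 + 4 * r)))))) by
        positivity)
    simp only [lt_min_iff] at h'
    exact ⟨d, h, h'⟩
  obtain ⟨h1, h2, h3, h4, h5, h6⟩ := hRR
  rw [lt_div_iff₀ (by positivity)] at h5 h6
  have hlow : ∀ u, ‖u - xbar‖ ≤ R → ((a - r / 2 * ‖u - xbar‖ ^ 2 : ℝ) : EReal) ≤ φ u :=
    fun u hu => hP.le_of_norm_sub_lt ha h0 hε (hu.trans_lt h3)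
  have key : ∀ c : ℝ, 0 < c → c ≤ 1 → ∀ u, ‖u - xbar‖ ≤ R / 2 →
      (a : EReal) ≤ φ u + ((c * ‖u - xbar‖ ^ 2 : ℝ) : EReal) := by
    intro c hc hc1 u₀ hu₀
    -- On the sphere of radius `R`, `φ` falls below `a` by at most `r / 2 * R²`, less than the
    -- penalty `9/16 * N` plus `c * R²`; the last term gives strictness when `r = 0`.
    set N : ℝ := r * R ^ 2 with hN
    have hN0 : 0 ≤ N := by positivity
    set Θ : E → ℝ := fun y => c * ‖y‖ ^ 2 + N * outerPenalty R y with hΘ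
    have hΘc : Continuous Θ := by
      have := continuous_outerPenalty (E := E) R
      simp only [hΘ]
      fun_prop
    have hΘ0 : Θ 0 = 0 := by
      simp [hΘ, outerPenalty_eq_zero hR (x := (0 : E)) (by simpa using (half_pos hR).le)]
    have hl : LowerSemicontinuousOn (fun y => φ y + (Θ (y - xbar) : EReal))
        (Metric.closedBall xbar R) := by
      intro y hy
      have hy' : LowerSemicontinuousAt φ y :=
        hd₂l y (Metric.closedBall_subset_ball h2 hy)
      have hΘy : ContinuousAt (fun y => (Θ (y - xbar) : EReal)) y :=
        (continuous_coe_real_ereal.comp (hΘc.comp (continuous_id.sub continuous_const))).continuousAt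
      exact (hy'.add' hΘy.lowerSemicontinuousAt (EReal.continuousAt_add
        (Or.inr (EReal.coe_ne_bot _)) (Or.inr (EReal.coe_ne_top _)))).lowerSemicontinuousWithinAt _
    have hxR : xbar ∈ Metric.closedBall xbar R := Metric.mem_closedBall_self hR.le
    obtain ⟨u, huR, humin⟩ :=
      hl.exists_isMinOn ⟨xbar, hxR⟩ (isCompact_closedBall xbar R)
    have hu : ‖u - xbar‖ ≤ R := mem_closedBall_iff_norm.1 huR
    have humin' : ∀ y, ‖y - xbar‖ ≤ R →
        φ u + (Θ (u - xbar) : EReal) ≤ φ y + (Θ (y - xbar) : EReal) :=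
      fun y hy => humin (mem_closedBall_iff_norm.2 hy)
    have hu0 : φ u + (Θ (u - xbar) : EReal) ≤ a := by
      have := humin' xbar (by simpa using hR.le)
      rwa [sub_self, hΘ0, ha, EReal.coe_zero, add_zero] at this
    have hlu := hlow u hu
    obtain ⟨b, hb⟩ : ∃ b : ℝ, φ u = b := by
      induction h : φ u with
      | bot => exact absurd (h ▸ hlu) (not_le.2 (EReal.bot_lt_coe _))
      | top => rw [h, EReal.top_add_coe] at hu0; exact absurd hu0 (not_le.2 (EReal.coe_lt_top _))
      | coe b => exact ⟨b, rfl⟩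
    rw [hb, ← EReal.coe_add, EReal.coe_le_coe_iff] at hu0
    rw [hb, EReal.coe_le_coe_iff] at hlu
    have hlt : ‖u - xbar‖ < R := by
      refine lt_of_le_of_ne hu fun heq => ?_
      have h7 : Θ (u - xbar) = c * R ^ 2 + N * (9 / 16) := by
        simp only [hΘ, heq, outerPenalty_of_norm_eq hR heq]
      rw [heq] at hlu
      nlinarith [mul_pos hc (pow_pos hR 2)]
    -- Otherwise `-q` is a subgradient at `u` and a strictly negative multiple of `u - xbar`,
    -- because `c > 0`. It is small enough for `hmono` since `‖q‖ ≤ R * (2 + 4 * r)`.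
    have hux : u = xbar := by
      by_contra hne
      set m := max 0 (‖u - xbar‖ ^ 2 / R ^ 2 - 1 / 4) with hm
      have hm0 : 0 ≤ m := le_max_left _ _
      have hm1 : m ≤ 1 := by
        refine max_le zero_le_one ?_
        have : ‖u - xbar‖ ^ 2 / R ^ 2 ≤ 1 := by
          rw [div_le_one (by positivity)]
          gcongr
        linarith
      set q : E := c • (2 : ℝ) • (u - xbar) + N • (4 * m / R ^ 2) • (u - xbar) with hq
      have hmaj : HasQuadraticMajorant Θ q (u - xbar) :=
        ((hasQuadraticMajorant_norm_sq _).const_mul hc.le).add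
          ((hasQuadraticMajorant_outerPenalty hR _).const_mul hN0)
      have hqe : q = (2 * c + 4 * r * m) • (u - xbar) := by
        have : N * (4 * m / R ^ 2) = 4 * r * m := by rw [hN]; field_simp
        rw [hq, smul_smul, smul_smul, this]
        module
      have hcoef : 2 * c + 4 * r * m ≤ 2 + 4 * r := by nlinarith
      have hqn : ‖q‖ ≤ R * (2 + 4 * r) := by
        rw [hqe, norm_smul, Real.norm_of_nonneg (by positivity), mul_comm]
        gcongr
      have hcont : Tendsto (fun y => ‖y - xbar‖) (𝓝 u) (𝓝 ‖u - xbar‖) :=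
        (tendsto_id.sub_const xbar).norm
      have hqmem : -q ∈ limitingSubdifferential φ u :=
        mem_limitingSubdifferential_of_isLocalMin hb hmaj (by
          filter_upwards [hcont.eventually_lt_const hlt] with y hy using humin' y hy.le)
      have hΘpos : 0 ≤ Θ (u - xbar) :=
        add_nonneg (by positivity) (mul_nonneg hN0 (outerPenalty_nonneg _ _))
      have hrR : r / 2 * ‖u - xbar‖ ^ 2 < ε := by
        have : ‖u - xbar‖ ^ 2 ≤ R := by nlinarith [norm_nonneg (u - xbar)]
        nlinarith
      have hT : -q ∈ attentiveLocalization φ xbar 0 ε u := by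
        refine ⟨hu.trans_lt h3, ⟨?_, ?_⟩, hqmem, by simpa using hqn.trans_lt h5⟩
        · rw [ha, hb]
          exact_mod_cast (by linarith : a - ε < b)
        · rw [ha, hb]
          exact_mod_cast (by linarith : b < a + ε)
      have h8 := hmono u (-q) hT (hu.trans_lt h1) (by simpa using hqn.trans_lt h6)
      rw [hqe, inner_neg_left, real_inner_smul_left, real_inner_self_eq_norm_sq] at h8
      have h9 : 0 < ‖u - xbar‖ := norm_pos_iff.2 (sub_ne_zero.2 hne)
      have h10 : 0 < (2 * c + 4 * r * m) * ‖u - xbar‖ ^ 2 := by positivity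
      linarith
    have h11 := humin' u₀ (by linarith)
    have h12 : Θ (u₀ - xbar) = c * ‖u₀ - xbar‖ ^ 2 := by
      simp only [hΘ, outerPenalty_eq_zero hR hu₀, mul_zero, add_zero]
    rwa [hux, sub_self, hΘ0, ha, EReal.coe_zero, add_zero, h12] at h11
  filter_upwards [Metric.ball_mem_nhds xbar (half_pos hR)] with u hu
  rw [mem_ball_iff_norm] at hu
  rw [ha]
  induction h : φ u with
  | bot => exact absurd (h ▸ hlow u (by linarith)) (not_le.2 (EReal.bot_lt_coe _))
  | top => exact le_top
  | coe b =>
    rw [EReal.coe_le_coe_iff]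
    -- The radius `R` does not depend on `c`, so `c → 0` is legitimate at each fixed `u`.
    have hb : ∀ᶠ c in 𝓝[>] (0 : ℝ), a ≤ b + c * ‖u - xbar‖ ^ 2 := by
      filter_upwards [Ioc_mem_nhdsGT (zero_lt_one' ℝ)] with c hc
      have := key c hc.1 hc.2 u hu.le
      rwa [h, ← EReal.coe_add, EReal.coe_le_coe_iff] at this
    have hlim : Tendsto (fun c : ℝ => b + c * ‖u - xbar‖ ^ 2) (𝓝[>] 0) (𝓝 b) := by
      have : Continuous fun c : ℝ => b + c * ‖u - xbar‖ ^ 2 := by fun_prop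
      simpa using (this.tendsto 0).mono_left nhdsWithin_le_nhds
    exact ge_of_tendsto hlim hb

theorem ProxInequality.isLocalMin_of_regularCoderivative_nonneg [ProperSpace E]
    (hP : ProxInequality φ xbar 0 ε r) (hε : 0 < ε) (hr : 0 ≤ r)
    (hprox : IsProxRegularAt φ xbar 0) {W : Set (E × E)} (hW : W ∈ 𝓝 (xbar, (0 : E)))
    (hpos : ∀ u v w z : E, v ∈ attentiveLocalization φ xbar 0 ε u → (u, v) ∈ W →
      z ∈ regularCoderivative (attentiveLocalization φ xbar 0 ε) u v w → 0 ≤ inner ℝ z w) :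
    IsLocalMin φ xbar := by
  obtain ⟨h0, ⟨hbot, htop⟩, hlsc, -⟩ := hprox
  have ha : φ xbar = ((φ xbar).toReal : EReal) := (EReal.coe_toReal htop hbot).symm
  obtain ⟨δ, hδ, hmono⟩ := hP.exists_inner_nonneg ha h0 hε hr hlsc hW hpos
  exact hP.isLocalMin_of_inner_nonneg ha h0 hε hr hlsc hδ hmono

theorem ProxInequality.mono {ε' : ℝ} (hP : ProxInequality φ xbar 0 ε r) (h : ε' ≤ ε) :
    ProxInequality φ xbar 0 ε' r := fun x u v hx hv hv' hu hφu =>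
  hP x u v (hx.trans_le h) hv (hv'.trans_le h) (hu.trans_le h)
    (hφu.trans_le (add_le_add_right (EReal.coe_le_coe_iff.2 h) _))

theorem attentiveLocalization_mono {ε' : ℝ} (h : ε' ≤ ε) (u : E) :
    attentiveLocalization φ xbar 0 ε' u ⊆ attentiveLocalization φ xbar 0 ε u := fun _ hv =>
  ⟨hv.1.trans_le h,
    ⟨(EReal.sub_le_sub le_rfl (EReal.coe_le_coe_iff.2 h)).trans_lt hv.2.1.1,
      hv.2.1.2.trans_le (add_le_add_right (EReal.coe_le_coe_iff.2 h) _)⟩,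
    hv.2.2.1, hv.2.2.2.trans_le h⟩

/-- Under subdifferential continuity the limiting subdifferential and its attentive localization
have the same graph locally. -/
theorem IsSubdifferentiallyContinuousAt.eventually_mem_iff
    (h : IsSubdifferentiallyContinuousAt φ xbar 0) (ha : φ xbar = a) (hε : 0 < ε) :
    ∀ᶠ p in 𝓝 (xbar, (0 : E)),
      p.2 ∈ attentiveLocalization φ xbar 0 ε p.1 ↔ p.2 ∈ limitingSubdifferential φ p.1 := by
  by_contra hcon
  obtain ⟨ps, hlim, hps⟩ := exists_seq_forall_of_frequently (not_eventually.1 hcon)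
  have h1 : Tendsto (fun k => (ps k).1) atTop (𝓝 xbar) := (continuous_fst.tendsto _).comp hlim
  have h2 : Tendsto (fun k => (ps k).2) atTop (𝓝 0) := (continuous_snd.tendsto _).comp hlim
  have hmem : ∀ k, (ps k).2 ∈ limitingSubdifferential φ (ps k).1 := fun k => by
    by_contra hk
    exact hps k ⟨fun hT => hT.2.2.1, fun hL => absurd hL hk⟩
  have h3 := h.2 _ _ h1 h2 hmem
  have h4 : φ xbar - (ε : EReal) < φ xbar := by
    rw [ha]; exact_mod_cast (by linarith : a - ε < a)
  have h5 : φ xbar < φ xbar + (ε : EReal) := by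
    rw [ha]; exact_mod_cast (by linarith : a < a + ε)
  have h6 : Tendsto (fun k => ‖(ps k).1 - xbar‖) atTop (𝓝 0) := by
    simpa using (h1.sub_const xbar).norm
  have h7 : Tendsto (fun k => ‖(ps k).2 - 0‖) atTop (𝓝 0) := by
    simpa using h2.norm
  obtain ⟨k, hk1, hk2, hk3, hk4⟩ := ((h6.eventually_lt_const hε).and
    ((h3.eventually_const_lt h4).and ((h3.eventually_lt_const h5).and
      (h7.eventually_lt_const hε)))).exists
  exact hps k ⟨fun hT => hT.2.2.1, fun hL => ⟨hk1, ⟨hk2, hk3⟩, hL, hk4⟩⟩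

theorem regularCoderivative_congr {T T' : E → Set E} {u v : E}
    (h : ∀ᶠ p in 𝓝 (u, v), p.2 ∈ T p.1 ↔ p.2 ∈ T' p.1) (w : E) :
    regularCoderivative T u v w = regularCoderivative T' u v w := by
  have hW : Tendsto (fun p : WithLp 2 (E × E) => (p.fst, p.snd))
      (𝓝 (WithLp.toLp 2 (u, v))) (𝓝 (u, v)) :=
    (WithLp.prod_continuous_ofLp 2 E E).tendsto (WithLp.toLp 2 (u, v))
  have hN : regularNormalCone (gph T) (WithLp.toLp 2 (u, v))
      = regularNormalCone (gph T') (WithLp.toLp 2 (u, v)) :=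
    regularNormalCone_congr (hW.eventually h)
  rw [regularCoderivative, regularCoderivative, hN]

theorem isLocalMin_of_combinedSecondSubdifferential_nonneg [ProperSpace E] (hε : 0 < ε)
    (hprox : IsProxRegularAt φ xbar 0) (hsub : IsSubdifferentiallyContinuousAt φ xbar 0)
    {W : Set (E × E)} (hW : W ∈ 𝓝 (xbar, (0 : E)))
    (hpos : ∀ u v w z : E, v ∈ attentiveLocalization φ xbar 0 ε u → (u, v) ∈ W →
      z ∈ combinedSecondSubdifferential φ u v w → 0 ≤ inner ℝ z w) :
    IsLocalMin φ xbar := by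
  obtain ⟨-, ⟨hbot, htop⟩, -, ε₀, hε₀, r, hr, hP⟩ := id hprox
  have ha : φ xbar = ((φ xbar).toReal : EReal) := (EReal.coe_toReal htop hbot).symm
  -- The given `ε` may exceed the prox-regularity radius; shrinking it only shrinks the graph on
  -- which the hypothesis is used.
  have hε' : 0 < min ε₀ ε := lt_min hε₀ hε
  -- Coderivatives are taken at points near `(xbar, 0)`, so the two graphs must agree around each
  -- such point.
  have hev := (hsub.eventually_mem_iff ha hε').eventually_nhds
  refine (hP.mono (min_le_left ε₀ ε)).isLocalMin_of_regularCoderivative_nonneg hε' hr hprox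
    (inter_mem hW hev) fun u v w z hv huv hz => ?_
  rw [regularCoderivative_congr huv.2] at hz
  exact hpos u v w z (attentiveLocalization_mono (min_le_right _ _) u hv) huv.1 hz

end LocalMinimum

end VarAnalysis

theorem corollary5p6 (n : ℕ) (φ : EuclideanSpace ℝ (Fin n) → EReal)
    (hφ : ∀ x, φ x ≠ ⊥) (xbar : EuclideanSpace ℝ (Fin n))
    (hprox : VarAnalysis.IsProxRegularAt φ xbar 0) :
    ((∃ ε : ℝ, 0 < ε ∧ (∃ r : ℝ, 0 ≤ r ∧ VarAnalysis.ProxInequality φ xbar 0 ε r) ∧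
        ∃ W ∈ 𝓝 (xbar, (0 : EuclideanSpace ℝ (Fin n))),
          ∀ u v w z : EuclideanSpace ℝ (Fin n),
            v ∈ VarAnalysis.attentiveLocalization φ xbar 0 ε u → (u, v) ∈ W →
            z ∈ VarAnalysis.regularCoderivative
              (VarAnalysis.attentiveLocalization φ xbar 0 ε) u v w →
            0 ≤ inner ℝ z w) →
      IsLocalMin φ xbar) ∧
    (VarAnalysis.IsSubdifferentiallyContinuousAt φ xbar 0 →
      (∃ ε : ℝ, 0 < ε ∧
        ∃ W ∈ 𝓝 (xbar, (0 : EuclideanSpace ℝ (Fin n))),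
          ∀ u v w z : EuclideanSpace ℝ (Fin n),
            v ∈ VarAnalysis.attentiveLocalization φ xbar 0 ε u → (u, v) ∈ W →
            z ∈ VarAnalysis.combinedSecondSubdifferential φ u v w →
            0 ≤ inner ℝ z w) →
      IsLocalMin φ xbar) := by
  constructor
  · rintro ⟨ε, hε, ⟨r, hr, hP⟩, W, hW, hpos⟩
    exact hP.isLocalMin_of_regularCoderivative_nonneg hε hr hprox hW hpos
  · rintro hsub ⟨ε, hε, W, hW, hpos⟩
    exact VarAnalysis.isLocalMin_of_combinedSecondSubdifferential_nonneg hε hprox hsub hW hpos
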